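/- For sets $A, S \subseteq \mathbb{N}$, say that $S$ computes $A$ if $A$ is Turing reducible to $S$. Let $A, B \subseteq \mathbb{N}$ with $B$ infinite. If every infinite subset of $B$ computes $A$, then there are an infinite set $C \subseteq B$ and a single Turing functional $\Phi$ such that $\Phi(S) = A$ for every infinite $S \subseteq C$; that is, for every such $S$, the functional $\Phi$ with oracle $S$ computes the characteristic function of $A$. -/

import Mathlib

/-- The characteristic function of a set of natural numbers, in the form in which it serves as an
oracle and as a target of a computation. -/
noncomputable def charFun (A : Set ℕ) : ℕ →. ℕ := by
  classical
  exact fun n => Part.some (if n ∈ A then 1 else 0)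

/-- `Computes S A`: the set `S` computes the set `A`, that is, `A` is Turing reducible to `S`. -/
def Computes (S A : Set ℕ) : Prop := TuringReducible (charFun A) (charFun S)

/-- (Programs for) Turing functionals: programs for partial recursive functions with an additional
instruction that queries the oracle. A program does not mention any particular oracle. -/
inductive TuringFunctional : Type
  | zero : TuringFunctional
  | succ : TuringFunctional
  | left : TuringFunctional
  | right : TuringFunctional
  | oracle : TuringFunctional
  | pair : TuringFunctional → TuringFunctional → TuringFunctional
  | comp : TuringFunctional → TuringFunctional → TuringFunctional
  | prec : TuringFunctional → TuringFunctional → TuringFunctional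
  | rfind : TuringFunctional → TuringFunctional

/-- The partial function computed by a Turing functional when it is run with oracle `g`.
The clauses are those of `Nat.RecursiveIn`. -/
def TuringFunctional.eval (g : ℕ →. ℕ) : TuringFunctional → (ℕ →. ℕ)
  | .zero => fun _ => Part.some 0
  | .succ => fun n => Part.some (n + 1)
  | .left => fun n => Part.some (Nat.unpair n).1
  | .right => fun n => Part.some (Nat.unpair n).2
  | .oracle => g
  | .pair f h => fun n => Nat.pair <$> f.eval g n <*> h.eval g n
  | .comp f h => fun n => h.eval g n >>= f.eval g
  | .prec f h => fun p =>
      let (a, n) := Nat.unpair p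
      n.rec (f.eval g a) fun y IH => do
        let i ← IH
        h.eval g (Nat.pair a (Nat.pair y i))
  | .rfind f => fun a =>
      Nat.rfind fun n => (fun m => m = 0) <$> f.eval g (Nat.pair a n)

/-- A function is Turing reducible to `g` exactly if some Turing functional computes it from `g`. -/
theorem turingReducible_iff_exists_functional (f g : ℕ →. ℕ) :
    TuringReducible f g ↔ ∃ Φ : TuringFunctional, Φ.eval g = f := by
  rw [TuringReducible, RecursiveIn.iff_nat]
  constructor
  · intro hf
    induction hf with
    | zero => exact ⟨.zero, rfl⟩
    | succ => exact ⟨.succ, rfl⟩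
    | left => exact ⟨.left, rfl⟩
    | right => exact ⟨.right, rfl⟩
    | oracle k hk => exact ⟨.oracle, (Set.mem_singleton_iff.mp hk).symm⟩
    | pair _ _ ihf ihh =>
      obtain ⟨a, rfl⟩ := ihf
      obtain ⟨b, rfl⟩ := ihh
      exact ⟨.pair a b, rfl⟩
    | comp _ _ ihf ihh =>
      obtain ⟨a, rfl⟩ := ihf
      obtain ⟨b, rfl⟩ := ihh
      exact ⟨.comp a b, rfl⟩
    | prec _ _ ihf ihh =>
      obtain ⟨a, rfl⟩ := ihf
      obtain ⟨b, rfl⟩ := ihh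
      exact ⟨.prec a b, rfl⟩
    | rfind _ ihf =>
      obtain ⟨a, rfl⟩ := ihf
      exact ⟨.rfind a, rfl⟩
  · rintro ⟨Φ, rfl⟩
    induction Φ with
    | zero => exact .zero
    | succ => exact .succ
    | left => exact .left
    | right => exact .right
    | oracle => exact .oracle g rfl
    | pair _ _ ihf ihh => exact .pair ihf ihh
    | comp _ _ ihf ihh => exact .comp ihf ihh
    | prec _ _ ihf ihh => exact .prec ihf ihh
    | rfind _ ihf => exact .rfind ihf

/-- `A` is introcomputable from `B`: every infinite subset of `B` computes `A`
(used for infinite `B`). -/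
def Introcomputable (A B : Set ℕ) : Prop :=
  ∀ S : Set ℕ, S ⊆ B → S.Infinite → Computes S A

/-- `A` is uniformly introcomputable from `B`: a single Turing functional computes `A` from every
infinite subset of `B` (used for infinite `B`). -/
def UniformlyIntrocomputable (A B : Set ℕ) : Prop :=
  ∃ Φ : TuringFunctional, ∀ S : Set ℕ, S ⊆ B → S.Infinite → Φ.eval (charFun S) = charFun A

/-! ### Ramsey theory of infinite sets of natural numbers -/

/-! By hypothesis the countably many families {S : Φ^S = A}, one for each functional Φ, cover the
infinite subsets of `B`. By the use principle (`exists_use`) each family is a countable intersection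
of open families. A category argument with Mathias conditions `(F, X)` finishes: if no condition put
`F ∪ S` into one and the same family for every infinite `S ⊆ X`, then successive extensions would
build an infinite `G ⊆ B` that leaves every family. These extensions come from
`exists_forall_union_mem`, which rests on the Ramsey property of open families. So some `(F, X)`
works for a single Φ. Hard-wiring the finite set `F` into Φ gives the required functional, with `C =
X`. -/

theorem Set.Infinite.inter_Ioi {X : Set ℕ} (hX : X.Infinite) (m : ℕ) :
    (X ∩ Set.Ioi m).Infinite := by
  have : X ∩ Set.Ioi m = X \ Set.Iic m := by ext; simp
  rw [this]
  exact hX.sdiff (Set.finite_Iic m)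

/-- Fusion: if the infinite sets satisfying `D k F` are dense and closed under infinite subsets,
then some infinite `Y ⊆ X` satisfies all of these properties on its tails. -/
theorem exists_fusion (D : ℕ → Finset ℕ → Set ℕ → Prop)
    (mono : ∀ k F X Y, Y ⊆ X → D k F X → D k F Y)
    (X : Set ℕ) (hX : X.Infinite)
    (dense : ∀ k F Z, Z ⊆ X → Z.Infinite → ∃ Y, Y ⊆ Z ∧ Y.Infinite ∧ D k F Y) :
    ∃ Y, Y ⊆ X ∧ Y.Infinite ∧
      ∀ m ∈ Y, ∀ k ≤ m, ∀ F : Finset ℕ, F ⊆ Finset.Iic m → D k F (Y ∩ Set.Ioi m) := by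
  have densePairs : ∀ (T : Finset (ℕ × Finset ℕ)) (Z : Set ℕ), Z ⊆ X → Z.Infinite →
      ∃ Y, Y ⊆ Z ∧ Y.Infinite ∧ ∀ t ∈ T, D t.1 t.2 Y := by
    intro T
    induction T using Finset.induction_on with
    | empty => exact fun Z _ hZ => ⟨Z, subset_rfl, hZ, by simp⟩
    | insert t T _ ih =>
      intro Z hZX hZ
      obtain ⟨Y, hYZ, hY, hYT⟩ := ih Z hZX hZ
      obtain ⟨W, hWY, hW, hWt⟩ := dense t.1 t.2 Y (hYZ.trans hZX) hY
      refine ⟨W, hWY.trans hYZ, hW, fun s hs => ?_⟩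
      rcases Finset.mem_insert.1 hs with rfl | hs
      · exact hWt
      · exact mono _ _ _ _ hWY (hYT s hs)
  let P := {p : ℕ × Set ℕ // p.1 ∈ p.2 ∧ p.2 ⊆ X ∧ p.2.Infinite}
  have step : ∀ p : P, ∃ q : P, q.1.2 ⊆ p.1.2 ∩ Set.Ioi p.1.1 ∧
      ∀ k ≤ p.1.1, ∀ F : Finset ℕ, F ⊆ Finset.Iic p.1.1 → D k F q.1.2 := by
    rintro ⟨⟨m, Z⟩, hm, hZX, hZ⟩
    obtain ⟨Y, hYZ, hY, hYT⟩ := densePairs (Finset.Iic m ×ˢ (Finset.Iic m).powerset)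
      (Z ∩ Set.Ioi m) (Set.inter_subset_left.trans hZX) (hZ.inter_Ioi m)
    obtain ⟨y, hy⟩ := hY.nonempty
    refine ⟨⟨(y, Y), hy, hYZ.trans (Set.inter_subset_left.trans hZX), hY⟩, hYZ, ?_⟩
    intro k hk F hF
    exact hYT (k, F) (by simpa using ⟨hk, hF⟩)
  choose next hnext hD using step
  obtain ⟨x, hx⟩ := hX.nonempty
  let p : ℕ → P := fun i => next^[i] ⟨(x, X), hx, subset_rfl, hX⟩
  have hp : ∀ i, p (i + 1) = next (p i) := fun i => Function.iterate_succ_apply' _ _ _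
  have anti : Antitone fun i => (p i).1.2 := by
    refine antitone_nat_of_succ_le fun i => ?_
    rw [hp]
    exact (hnext (p i)).trans Set.inter_subset_left
  have smono : StrictMono fun i => (p i).1.1 := by
    refine strictMono_nat_of_lt_succ fun i => ?_
    rw [hp]
    exact (hnext (p i) (next (p i)).2.1).2
  -- All chosen points after the `i`-th lie in reservoir `i + 1`, which was thinned for every pair
  -- bounded by the `i`-th point.
  refine ⟨Set.range fun i => (p i).1.1, ?_, Set.infinite_range_of_injective smono.injective, ?_⟩
  · rintro _ ⟨i, rfl⟩
    exact (p i).2.2.1 (p i).2.1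
  · rintro _ ⟨i, rfl⟩ k hk F hF
    refine mono k F _ _ ?_ (hD (p i) k hk F hF)
    rintro _ ⟨⟨j, rfl⟩, hj⟩
    have hij : i + 1 ≤ j := smono.lt_iff_lt.1 hj
    rw [← hp]
    exact anti hij (p j).2.1

/-- A family of sets of natural numbers is open if membership is always witnessed by a finite
initial segment. -/
def IsOpenFamily (U : Set (Set ℕ)) : Prop :=
  ∀ G ∈ U, ∃ m, ∀ H : Set ℕ, (∀ i ≤ m, i ∈ H ↔ i ∈ G) → H ∈ U

theorem IsOpenFamily.preimage_union {U : Set (Set ℕ)} (hU : IsOpenFamily U) (F : Set ℕ) :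
    IsOpenFamily {S | F ∪ S ∈ U} := by
  intro G hG
  obtain ⟨m, hm⟩ := hU _ hG
  exact ⟨m, fun H hH => hm _ fun i hi => by simp [hH i hi]⟩

/-- `X` accepts `F` into `U`: all infinite subsets of `X` together with `F` are in `U`. -/
def Accepts (U : Set (Set ℕ)) (F : Finset ℕ) (X : Set ℕ) : Prop :=
  ∀ S, S ⊆ X → S.Infinite → ↑F ∪ S ∈ U

/-- `X` rejects `F`: no infinite subset of `X` accepts `F`. -/
def Rejects (U : Set (Set ℕ)) (F : Finset ℕ) (X : Set ℕ) : Prop :=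
  ∀ Y, Y ⊆ X → Y.Infinite → ¬ Accepts U F Y

theorem Accepts.mono {U : Set (Set ℕ)} {F : Finset ℕ} {X Y : Set ℕ} (h : Accepts U F X)
    (hYX : Y ⊆ X) : Accepts U F Y :=
  fun S hS => h S (hS.trans hYX)

theorem Rejects.mono {U : Set (Set ℕ)} {F : Finset ℕ} {X Y : Set ℕ} (h : Rejects U F X)
    (hYX : Y ⊆ X) : Rejects U F Y :=
  fun S hS => h S (hS.trans hYX)

/-- Fusion lets the tails decide every `insert y F`. If infinitely many `y` accept, the set of these
accepts `F`: split an infinite subset into its minimum and the rest. Otherwise discard the finitely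
many accepting `y`. -/
theorem exists_accepts_or_forall_rejects_insert (U : Set (Set ℕ)) (F : Finset ℕ) (X : Set ℕ)
    (hX : X.Infinite) : ∃ Y, Y ⊆ X ∧ Y.Infinite ∧
      (Accepts U F Y ∨ ∀ y ∈ Y, Rejects U (insert y F) (Y ∩ Set.Ioi y)) := by
  classical
  obtain ⟨Y, hYX, hY, hdec⟩ := exists_fusion
    (fun _ E Z => Accepts U (E ∪ F) Z ∨ Rejects U (E ∪ F) Z)
    (fun _ _ _ _ h => Or.imp (·.mono h) (·.mono h)) X hX (by
      intro _ E Z _ hZ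
      by_cases h : Rejects U (E ∪ F) Z
      · exact ⟨Z, subset_rfl, hZ, Or.inr h⟩
      · simp only [Rejects, not_forall, not_not] at h
        obtain ⟨Y, hYZ, hY, h⟩ := h
        exact ⟨Y, hYZ, hY, Or.inl h⟩)
  have hdec' : ∀ y ∈ Y, Accepts U (insert y F) (Y ∩ Set.Ioi y) ∨
      Rejects U (insert y F) (Y ∩ Set.Ioi y) := fun y hy => by
    simpa [← Finset.insert_eq] using hdec y hy y le_rfl {y} (by simp)
  by_cases hacc : {y ∈ Y | Accepts U (insert y F) (Y ∩ Set.Ioi y)}.Infinite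
  · refine ⟨_, (Set.sep_subset _ _).trans hYX, hacc, Or.inl fun S hS hSinf => ?_⟩
    have hmin := Nat.sInf_mem hSinf.nonempty
    have := (hS hmin).2 (S ∩ Set.Ioi (sInf S))
      (Set.inter_subset_inter_left _ (hS.trans (Set.sep_subset _ _))) (hSinf.inter_Ioi _)
    convert this using 1
    ext i
    have h1 : i ∈ S → i = sInf S ∨ sInf S < i :=
      fun hi => (Nat.sInf_le hi).eq_or_lt.imp_left Eq.symm
    have h2 : i = sInf S → i ∈ S := fun h => h ▸ hmin
    simp only [Set.mem_union, Finset.mem_coe, Finset.mem_insert, Set.mem_inter_iff, Set.mem_Ioi]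
    tauto
  · rw [Set.not_infinite] at hacc
    refine ⟨_, Set.sdiff_subset.trans hYX, hY.sdiff hacc, Or.inr fun y hy => ?_⟩
    refine ((hdec' y hy.1).resolve_left fun h => hy.2 ⟨hy.1, h⟩).mono ?_
    exact Set.inter_subset_inter_left _ Set.sdiff_subset

/-- Open families of infinite sets of natural numbers are Ramsey. -/
theorem IsOpenFamily.isRamsey {U : Set (Set ℕ)} (hU : IsOpenFamily U) (X : Set ℕ)
    (hX : X.Infinite) : ∃ Y, Y ⊆ X ∧ Y.Infinite ∧
      ((∀ S, S ⊆ Y → S.Infinite → S ∈ U) ∨ ∀ S, S ⊆ Y → S.Infinite → S ∉ U) := by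
  classical
  obtain ⟨Z, hZX, hZ, hZ0⟩ := exists_accepts_or_forall_rejects_insert U ∅ X hX
  rcases hZ0 with hacc | hrej
  · exact ⟨Z, hZX, hZ, Or.inl fun S hS hSinf => by simpa using hacc S hS hSinf⟩
  obtain ⟨Y, hYZ, hY, hdec⟩ := exists_fusion
    (fun _ F W => Accepts U F W ∨ ∀ y ∈ W, Rejects U (insert y F) (W ∩ Set.Ioi y))
    (fun _ _ _ _ h => Or.imp (·.mono h) fun h' y hy =>
      (h' y (h hy)).mono (Set.inter_subset_inter_left _ h)) Z hZ
    (fun _ F W _ hW => exists_accepts_or_forall_rejects_insert U F W hW)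
  -- Here `m` is the maximum of `F`. Singletons are rejected by `hrej`; a rejected `F` is not
  -- accepted by its tail, so `hdec` rejects its one-point extensions.
  have key : ∀ F : Finset ℕ, ↑F ⊆ Y → ∀ m ∈ F, F ⊆ Finset.Iic m →
      Rejects U F (Y ∩ Set.Ioi m) := by
    intro F
    induction F using Finset.induction_on_max with
    | empty => simp
    | insert a F hmax ih =>
      intro hFY m hm hFm
      obtain rfl : m = a := by
        refine le_antisymm ?_ (Finset.mem_Iic.1 (hFm (Finset.mem_insert_self _ _)))
        rcases Finset.mem_insert.1 hm with rfl | h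
        · exact le_rfl
        · exact (hmax m h).le
      have haY : m ∈ Y := hFY (by simp)
      rcases F.eq_empty_or_nonempty with rfl | hne
      · exact (hrej m (hYZ haY)).mono (Set.inter_subset_inter_left _ hYZ)
      · have hbF := F.max'_mem hne
        have hFY' : (F : Set ℕ) ⊆ Y := fun i hi => hFY (by simp [Finset.mem_coe.1 hi])
        have hFb : F ⊆ Finset.Iic (F.max' hne) := fun i hi => by simpa using F.le_max' i hi
        have hbm := hmax _ hbF
        have hr := ih hFY' _ hbF hFb
        have := ((hdec _ (hFY' hbF) 0 (Nat.zero_le _) F hFb).resolve_left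
          (hr _ subset_rfl (hY.inter_Ioi _))) m ⟨haY, hbm⟩
        exact this.mono fun i hi => ⟨⟨hi.1, hbm.trans hi.2⟩, hi.2⟩
  refine ⟨Y, hYZ.trans hZX, hY, Or.inr fun S hS hSinf hSU => ?_⟩
  -- By openness the part of `S` up to `n > m` already forces membership in `U`, so a tail of `Y`
  -- accepts it, against `key`.
  obtain ⟨m, hm⟩ := hU S hSU
  obtain ⟨n, hn, hmn⟩ := hSinf.exists_gt m
  have hmem : ∀ i, i ∈ (Finset.Iic n).filter (· ∈ S) ↔ i ≤ n ∧ i ∈ S := fun i => by simp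
  refine key ((Finset.Iic n).filter (· ∈ S)) (fun i hi => hS ((hmem i).1 hi).2) n
    ((hmem n).2 ⟨le_rfl, hn⟩) (Finset.filter_subset _ _) _ subset_rfl (hY.inter_Ioi n) ?_
  intro T hT _
  refine hm _ fun i hi => ?_
  have hin : i ≤ n := hi.trans hmn.le
  rw [Set.mem_union, Finset.mem_coe, hmem]
  have : i ∉ T := fun h => (not_lt.2 hin) (hT h).2
  tauto

/-! ### Mathias conditions and countable covers. -/

/-- If no condition below `(F, X)` is disjoint from some member of a sequence of open families,
then some infinite `Y ⊆ X` has `F ∪ S` in all of them, for every infinite `S ⊆ Y`. -/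
theorem exists_forall_union_mem (U : ℕ → Set (Set ℕ)) (hU : ∀ n, IsOpenFamily (U n))
    (F : Finset ℕ) (X : Set ℕ) (hX : X.Infinite)
    (h : ∀ (E : Finset ℕ) (Y : Set ℕ) (n : ℕ), ↑E ⊆ X → Y ⊆ X → Y.Infinite →
      ∃ S, S ⊆ Y ∧ S.Infinite ∧ (F ∪ E : Set ℕ) ∪ S ∈ U n) :
    ∃ Y, Y ⊆ X ∧ Y.Infinite ∧ ∀ S, S ⊆ Y → S.Infinite → ∀ n, ↑F ∪ S ∈ U n := by
  classical
  obtain ⟨Y, hYX, hY, hdec⟩ := exists_fusion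
    (fun n E Z => ↑E ⊆ X → ∀ S, S ⊆ Z → S.Infinite → (F ∪ E : Set ℕ) ∪ S ∈ U n)
    (fun _ _ _ _ h h' hE S hS => h' hE S (hS.trans h)) X hX (by
      intro n E Z hZX hZ
      obtain ⟨Y, hYZ, hY, hpos | hneg⟩ :=
        ((hU n).preimage_union (F ∪ E : Set ℕ)).isRamsey Z hZ
      · exact ⟨Y, hYZ, hY, fun _ => hpos⟩
      · refine ⟨Z, subset_rfl, hZ, fun hE => ?_⟩
        obtain ⟨S, hS, hSinf, hSU⟩ := h E Y n hE (hYZ.trans hZX) hY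
        exact absurd hSU (hneg S hS hSinf))
  refine ⟨Y, hYX, hY, fun S hS hSinf n => ?_⟩
  -- Cutting `S` at one of its points above `n` brings the index `n` within reach of the fusion.
  obtain ⟨m, hm, hnm⟩ := hSinf.exists_gt n
  have := hdec m (hS hm) n hnm.le ((Finset.Iic m).filter (· ∈ S)) (Finset.filter_subset _ _)
    (fun i hi => hYX (hS (by simpa using (Finset.mem_filter.1 hi).2))) (S ∩ Set.Ioi m)
    (Set.inter_subset_inter_left _ hS) (hSinf.inter_Ioi m)
  convert this using 1
  ext i
  have := le_or_gt i m
  simp only [Set.mem_union, Finset.mem_coe, Finset.mem_filter, Finset.mem_Iic, Set.mem_inter_iff,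
    Set.mem_Ioi]
  tauto

/-- If the infinite subsets of `B` are covered by countably many intersections of sequences of open
families, then one of these intersections contains all infinite sets given by some Mathias
condition. -/
theorem exists_mathias_condition_of_cover {ι : Type*} [Countable ι] (U : ι → ℕ → Set (Set ℕ))
    (hU : ∀ e n, IsOpenFamily (U e n)) (B : Set ℕ) (hB : B.Infinite)
    (hcover : ∀ S, S ⊆ B → S.Infinite → ∃ e, ∀ n, S ∈ U e n) :
    ∃ (e : ι) (F : Finset ℕ) (X : Set ℕ), X ⊆ B ∧ X.Infinite ∧
      ∀ S, S ⊆ X → S.Infinite → ∀ n, ↑F ∪ S ∈ U e n := by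
  classical
  by_contra hno
  obtain ⟨e₀, -⟩ := hcover B subset_rfl hB
  obtain ⟨enum, henum⟩ := @exists_surjective_nat ι ⟨e₀⟩ _
  let P := {p : Finset ℕ × Set ℕ // ↑p.1 ⊆ B ∧ p.2 ⊆ B ∧ p.2.Infinite}
  have step : ∀ (k : ℕ) (p : P), ∃ q : P, p.1.1 ⊆ q.1.1 ∧ (q.1.1 : Set ℕ) ⊆ p.1.1 ∪ p.1.2 ∧
      q.1.2 ⊆ p.1.2 ∧ (∃ i ∈ q.1.1, k ≤ i) ∧
      ∃ n, ∀ S, S ⊆ q.1.2 → S.Infinite → ↑q.1.1 ∪ S ∉ U (enum k) n := by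
    rintro k ⟨⟨F, X⟩, hF, hX, hXinf⟩
    -- Putting some `i > k` into the stem at each stage `k` makes the limit set infinite.
    obtain ⟨i, hiX, hki⟩ := hXinf.exists_gt k
    have := mt (exists_forall_union_mem (U (enum k)) (hU _) (insert i F) X hXinf)
      (fun ⟨Y, hYX, hY, h⟩ => hno ⟨_, _, Y, hYX.trans hX, hY, h⟩)
    push Not at this
    obtain ⟨E, Y, n, hE, hYX, hY, h⟩ := this
    refine ⟨⟨(insert i F ∪ E, Y), ?_, hYX.trans hX, hY⟩, ?_, ?_, hYX, ⟨i, by simp, hki.le⟩, n, ?_⟩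
    · intro j hj
      simp only [Finset.coe_union, Finset.coe_insert, Set.mem_union, Set.mem_insert_iff] at hj
      rcases hj with (rfl | hj) | hj
      · exact hX hiX
      · exact hF hj
      · exact hX (hE hj)
    · exact (Finset.subset_insert _ _).trans Finset.subset_union_left
    · intro j hj
      simp only [Finset.coe_union, Finset.coe_insert, Set.mem_union, Set.mem_insert_iff] at hj
      rcases hj with (rfl | hj) | hj
      · exact Or.inr hiX
      · exact Or.inl hj
      · exact Or.inr (hE hj)
    · intro S hS hSinf
      simpa [Set.insert_union] using h S hS hSinf
  choose next hle hsub hanti hnew hneg using step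
  let p : ℕ → P := fun k => Nat.rec ⟨(∅, B), by simp, subset_rfl, hB⟩ (fun k q => next k q) k
  have hp : ∀ k, p (k + 1) = next k (p k) := fun _ => rfl
  have later : ∀ k l, k ≤ l → (p k).1.1 ⊆ (p l).1.1 ∧
      ((p l).1.1 : Set ℕ) ⊆ (p k).1.1 ∪ (p k).1.2 ∧ (p l).1.2 ⊆ (p k).1.2 := by
    intro k l hkl
    induction l, hkl using Nat.le_induction with
    | base => exact ⟨subset_rfl, Set.subset_union_left, subset_rfl⟩
    | succ l _ ih =>
      rw [hp]
      refine ⟨ih.1.trans (hle l _), ?_, (hanti l _).trans ih.2.2⟩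
      exact (hsub l _).trans (Set.union_subset ih.2.1 (ih.2.2.trans Set.subset_union_right))
  let G : Set ℕ := ⋃ k, ((p k).1.1 : Set ℕ)
  have hGB : G ⊆ B := Set.iUnion_subset fun k => (p k).2.1
  have hG : G.Infinite := by
    refine Set.infinite_of_not_bddAbove fun ⟨b, hb⟩ => ?_
    obtain ⟨i, hi, hbi⟩ := hnew (b + 1) (p (b + 1))
    have := hb (Set.mem_iUnion.2 ⟨b + 1 + 1, hi⟩)
    omega
  obtain ⟨e, he⟩ := hcover G hGB hG
  obtain ⟨k, rfl⟩ := henum e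
  obtain ⟨n, hn⟩ := hneg k (p k)
  rw [← hp] at hn
  -- Outside the stem of stage `k + 1`, `G` lies in that stage's reservoir.
  refine hn (G \ (p (k + 1)).1.1) ?_ (hG.sdiff (Finset.finite_toSet _)) ?_
  · rintro i ⟨hi, hi'⟩
    obtain ⟨l, hl⟩ := Set.mem_iUnion.1 hi
    have h1 := (later l (max l (k + 1)) (le_max_left _ _)).1 hl
    exact ((later (k + 1) (max l (k + 1)) (le_max_right _ _)).2.1 h1).resolve_left hi'
  · rw [Set.union_sdiff_cancel (Set.subset_iUnion (fun k => ((p k).1.1 : Set ℕ)) (k + 1))]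
    exact he n

/-! ### Turing functionals -/

namespace TuringFunctional

/-- A numerical code for each Turing functional. -/
def toNat : TuringFunctional → ℕ
  | .zero => Nat.pair 0 0
  | .succ => Nat.pair 1 0
  | .left => Nat.pair 2 0
  | .right => Nat.pair 3 0
  | .oracle => Nat.pair 4 0
  | .pair f h => Nat.pair 5 (Nat.pair f.toNat h.toNat)
  | .comp f h => Nat.pair 6 (Nat.pair f.toNat h.toNat)
  | .prec f h => Nat.pair 7 (Nat.pair f.toNat h.toNat)
  | .rfind f => Nat.pair 8 f.toNat

theorem toNat_injective : Function.Injective toNat := by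
  intro Φ
  induction Φ with
  | zero | succ | left | right | oracle =>
    intro Ψ h
    cases Ψ <;> simp [toNat, Nat.pair_eq_pair] at h ⊢
  | pair f h ihf ihh | comp f h ihf ihh | prec f h ihf ihh =>
    intro Ψ h
    cases Ψ <;> simp [toNat, Nat.pair_eq_pair] at h ⊢
    exact ⟨ihf h.1, ihh h.2⟩
  | rfind f ihf =>
    intro Ψ h
    cases Ψ <;> simp [toNat, Nat.pair_eq_pair] at h ⊢
    exact ihf h

instance : Countable TuringFunctional := toNat_injective.countable

/-- Use principle: a halting computation depends only on finitely many values of the oracle. -/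
theorem exists_use (Φ : TuringFunctional) {g : ℕ →. ℕ} {n v : ℕ} (hv : v ∈ Φ.eval g n) :
    ∃ m, ∀ g' : ℕ →. ℕ, (∀ i ≤ m, g' i = g i) → v ∈ Φ.eval g' n := by
  induction Φ generalizing n v with
  | zero | succ | left | right => exact ⟨0, fun _ _ => hv⟩
  | oracle => exact ⟨n, fun g' h => by simpa only [eval, h n le_rfl] using hv⟩
  | pair f h ihf ihh =>
    simp only [eval, Seq.seq, Part.map_eq_map, Part.mem_bind_iff, Part.mem_map_iff] at hv ⊢
    obtain ⟨_, ⟨a, ha, rfl⟩, b, hb, rfl⟩ := hv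
    obtain ⟨m₁, h₁⟩ := ihf ha
    obtain ⟨m₂, h₂⟩ := ihh hb
    exact ⟨max m₁ m₂, fun g' hg' =>
      ⟨_, ⟨a, h₁ g' fun i hi => hg' i (le_max_of_le_left hi), rfl⟩, b,
        h₂ g' fun i hi => hg' i (le_max_of_le_right hi), rfl⟩⟩
  | comp f h ihf ihh =>
    obtain ⟨a, ha, hv⟩ := Part.mem_bind_iff.1 hv
    obtain ⟨m₁, h₁⟩ := ihh ha
    obtain ⟨m₂, h₂⟩ := ihf hv
    exact ⟨max m₁ m₂, fun g' hg' => Part.mem_bind_iff.2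
      ⟨a, h₁ g' fun i hi => hg' i (le_max_of_le_left hi),
        h₂ g' fun i hi => hg' i (le_max_of_le_right hi)⟩⟩
  | prec f h ihf ihh =>
    simp only [eval] at hv ⊢
    generalize (Nat.unpair n).1 = a at hv ⊢
    generalize (Nat.unpair n).2 = k at hv ⊢
    induction k generalizing v with
    | zero => exact ihf hv
    | succ k ih =>
      simp only [Part.bind_eq_bind, Part.mem_bind_iff] at hv ⊢
      obtain ⟨b, hb, hv⟩ := hv
      obtain ⟨m₁, h₁⟩ := ih hb
      obtain ⟨m₂, h₂⟩ := ihh hv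
      exact ⟨max m₁ m₂, fun g' hg' =>
        ⟨b, h₁ g' fun i hi => hg' i (le_max_of_le_left hi),
          h₂ g' fun i hi => hg' i (le_max_of_le_right hi)⟩⟩
  | rfind f ihf =>
    obtain ⟨hv, hlt⟩ := Nat.mem_rfind.1 hv
    obtain ⟨b, hb, hb0⟩ := (Part.mem_map_iff _).1 hv
    obtain ⟨m, hm⟩ := ihf hb
    -- The nonzero values before `v` must persist too; the bound 0 for `j ≥ v` is a dummy.
    have : ∀ j, ∃ mj, j < v → ∀ g' : ℕ →. ℕ, (∀ i ≤ mj, g' i = g i) →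
        ∃ c, c ∈ f.eval g' (Nat.pair n j) ∧ decide (c = 0) = false := by
      intro j
      by_cases hj : j < v
      · obtain ⟨c, hc, hc0⟩ := (Part.mem_map_iff _).1 (hlt hj)
        obtain ⟨mj, hmj⟩ := ihf hc
        exact ⟨mj, fun _ g' hg' => ⟨c, hmj g' hg', hc0⟩⟩
      · exact ⟨0, fun h => absurd h hj⟩
    choose bound hbound using this
    refine ⟨max m ((Finset.range v).sup bound), fun g' hg' => Nat.mem_rfind.2
      ⟨(Part.mem_map_iff _).2 ⟨b, hm g' fun i hi => hg' i (le_max_of_le_left hi), hb0⟩,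
        fun {j} hj => (Part.mem_map_iff _).2 ?_⟩⟩
    exact hbound j hj g' fun i hi => hg' i
      (le_max_of_le_right (hi.trans (Finset.le_sup (Finset.mem_range.2 hj))))

theorem charFun_congr {G H : Set ℕ} {i j : ℕ} (h : i ∈ H ↔ j ∈ G) :
    charFun H i = charFun G j := by
  by_cases hj : j ∈ G <;> simp [charFun, h, hj]

theorem isOpenFamily_setOf_mem_eval (Φ : TuringFunctional) (n v : ℕ) :
    IsOpenFamily {G | v ∈ Φ.eval (charFun G) n} := by
  intro G hG
  obtain ⟨m, hm⟩ := Φ.exists_use hG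
  exact ⟨m, fun H hH => hm _ fun i hi => charFun_congr (hH i hi)⟩

/-- Replace every oracle query of a Turing functional by a run of `Ψ`. -/
def substOracle (Ψ : TuringFunctional) : TuringFunctional → TuringFunctional
  | .zero => .zero
  | .succ => .succ
  | .left => .left
  | .right => .right
  | .oracle => Ψ
  | .pair f h => .pair (substOracle Ψ f) (substOracle Ψ h)
  | .comp f h => .comp (substOracle Ψ f) (substOracle Ψ h)
  | .prec f h => .prec (substOracle Ψ f) (substOracle Ψ h)
  | .rfind f => .rfind (substOracle Ψ f)

theorem eval_substOracle (Ψ Φ : TuringFunctional) (g : ℕ →. ℕ) :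
    (substOracle Ψ Φ).eval g = Φ.eval (Ψ.eval g) := by
  induction Φ with
  | zero | succ | left | right | oracle => rfl
  | pair _ _ ihf ihh | comp _ _ ihf ihh | prec _ _ ihf ihh =>
    simp only [substOracle, eval, ihf, ihh]
    rfl
  | rfind _ ihf =>
    simp only [substOracle, eval, ihf]
    rfl

theorem exists_eval_eq_of_partrec {f : ℕ →. ℕ} (hf : Nat.Partrec f) :
    ∃ Φ : TuringFunctional, ∀ g, Φ.eval g = f := by
  induction hf with
  | zero => exact ⟨.zero, fun _ => rfl⟩
  | succ => exact ⟨.succ, fun _ => rfl⟩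
  | left => exact ⟨.left, fun _ => rfl⟩
  | right => exact ⟨.right, fun _ => rfl⟩
  | pair _ _ ihf ihh =>
    obtain ⟨Φ, hΦ⟩ := ihf
    obtain ⟨Ψ, hΨ⟩ := ihh
    exact ⟨.pair Φ Ψ, fun g => by simp only [eval, hΦ, hΨ]; rfl⟩
  | comp _ _ ihf ihh =>
    obtain ⟨Φ, hΦ⟩ := ihf
    obtain ⟨Ψ, hΨ⟩ := ihh
    exact ⟨.comp Φ Ψ, fun g => by simp only [eval, hΦ, hΨ]; rfl⟩
  | prec _ _ ihf ihh =>
    obtain ⟨Φ, hΦ⟩ := ihf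
    obtain ⟨Ψ, hΨ⟩ := ihh
    exact ⟨.prec Φ Ψ, fun g => by simp only [eval, hΦ, hΨ]; rfl⟩
  | rfind _ ihf =>
    obtain ⟨Φ, hΦ⟩ := ihf
    exact ⟨.rfind Φ, fun g => by simp only [eval, hΦ]; rfl⟩

theorem exists_eval_charFun_eq_insert (a : ℕ) :
    ∃ Φ : TuringFunctional, ∀ S, Φ.eval (charFun S) = charFun (insert a S) := by
  -- To be applied to the pair of `n` and the oracle's answer at `n`.
  have hprim : Primrec fun p : ℕ => if p.unpair.1 = a then 1 else p.unpair.2 :=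
    Primrec.ite (Primrec.eq.comp (Primrec.fst.comp Primrec.unpair) (Primrec.const a))
      (Primrec.const 1) (Primrec.snd.comp Primrec.unpair)
  obtain ⟨Φ, hΦ⟩ := exists_eval_eq_of_partrec (Nat.Partrec.of_primrec (Primrec.nat_iff.1 hprim))
  obtain ⟨I, hI⟩ := exists_eval_eq_of_partrec (Nat.Partrec.of_primrec Nat.Primrec.id)
  refine ⟨.comp Φ (.pair I .oracle), fun S => funext fun n => ?_⟩
  simp only [eval, hΦ, hI, Seq.seq]
  by_cases hS : n ∈ S <;> by_cases h : n = a <;> simp_all [charFun] <;>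
    exact (Part.bind_some _ _).trans (by simp [h])

/-- Every Turing functional can be run with a finite set added to its oracle. -/
theorem exists_eval_charFun_eq_union (F : Finset ℕ) (Φ : TuringFunctional) :
    ∃ Ψ : TuringFunctional, ∀ S, Ψ.eval (charFun S) = Φ.eval (charFun (↑F ∪ S)) := by
  induction F using Finset.induction_on generalizing Φ with
  | empty => exact ⟨Φ, fun S => by simp⟩
  | insert a F _ ih =>
    obtain ⟨I, hI⟩ := exists_eval_charFun_eq_insert a
    obtain ⟨Ψ, hΨ⟩ := ih (substOracle I Φ)
    exact ⟨Ψ, fun S => by rw [hΨ, eval_substOracle, hI, Finset.coe_insert, Set.insert_union]⟩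

/-- As `charFun A` is total, computing it amounts to countably many halting conditions, each open in
the oracle set. -/
theorem eval_eq_charFun_iff (Φ : TuringFunctional) (g : ℕ →. ℕ) (A : Set ℕ) :
    Φ.eval g = charFun A ↔ ∀ n, (charFun A n).get trivial ∈ Φ.eval g n := by
  constructor
  · intro h n
    rw [h]
    exact Part.get_mem _
  · intro h
    funext n
    exact (Part.eq_some_iff.2 (h n)).trans (Part.some_get _)

end TuringFunctional

theorem theorem1p2 (A B : Set ℕ) (hB : B.Infinite) (hAB : Introcomputable A B) :
    ∃ C : Set ℕ, C ⊆ B ∧ C.Infinite ∧ UniformlyIntrocomputable A C := by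
  obtain ⟨Φ, F, C, hCB, hC, hΦ⟩ := exists_mathias_condition_of_cover
    (fun (Φ : TuringFunctional) n => {G | (charFun A n).get trivial ∈ Φ.eval (charFun G) n})
    (fun Φ n => Φ.isOpenFamily_setOf_mem_eval n _) B hB (fun S hSB hS => by
      obtain ⟨Φ, hΦ⟩ := (turingReducible_iff_exists_functional _ _).1 (hAB S hSB hS)
      exact ⟨Φ, (Φ.eval_eq_charFun_iff _ A).1 hΦ⟩)
  obtain ⟨Ψ, hΨ⟩ := Φ.exists_eval_charFun_eq_union F
  refine ⟨C, hCB, hC, Ψ, fun S hSC hS => ?_⟩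
  rw [hΨ]
  exact (Φ.eval_eq_charFun_iff _ A).2 (hΦ S hSC hS)
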